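/- Let $1\le M<N$ be integers, $0<p<1$, $r\ge 1$, and let $X\subseteq\mathbb R^N$ be a set with $0\in X$ such that every nonempty relatively open subset of $X$ has positive Lebesgue measure. Let $f:X\to X$ and $h:X\to\mathbb R^M$ be $C^r$ (on a neighbourhood of $X$) with $f(0)=0$, $h(0)=0$, and write $A(x)=\frac{\partial f}{\partial x}(x)$, $C(x)=\frac{\partial h}{\partial x}(x)$. Assume that $a_1I_N\le A(x)'A(x)\le a_2I_N$ for all $x\in X$ with some constants $a_1,a_2>0$, and that the map $\theta(x)=(h(x),h(f(x)),\dots,h(f^{N-1}(x)))$ satisfies $\operatorname{rank}\frac{\partial\theta}{\partial x}(x)=N$ and $\alpha I_N<\frac{\partial\theta}{\partial x}(x)'\frac{\partial\theta}{\partial x}(x)<\beta I_N$ for all $x\in X$ with some constants $\alpha,\beta>0$. Let the observer gain $K$ be a $C^r$ map from a neighbourhood of $h(X)$ in $\mathbb R^M$ to $\mathbb R^N$ with $K(0)=0$ and with derivative $\frac{\partial K}{\partial y}$ bounded on $h(X)$. Let $\xi_0,\xi_1,\dots$ be independent $\{0,1\}$-valued random variables with $\operatorname{Prob}(\xi_t=1)=p$.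 Suppose that the linearized error dynamics $$\eta_{t+1}=\Big(\frac{\partial f}{\partial x}(x_t)-\xi_t\frac{\partial (K\circ h)}{\partial x}(x_t)\Big)\eta_t,\qquad x_{t+1}=f(x_t),$$ is mean square exponentially stable: there are constants $0<L<\infty$ and $0<\bar\beta<1$ such that, for Lebesgue almost all $x_0\in X$ and $\eta_0\in\mathbb R^N$, $E\|\eta_{t+1}\|^2\le L\bar\beta^{\,t}\|\eta_0\|^2$ for all $t\ge0$. Then there exist $N\times N$ matrix functions $Q_0$ and $R$ on $X$ and constants $\gamma_1,\gamma_2>0$ such that $\gamma_1I_N\le Q_0(x)\le\gamma_2I_N$ and $R(x)$ is symmetric positive semidefinite for all $x\in X$; $Q_0$ solves the Riccati equation $$Q_0(f(x))=A(x)Q_0(x)A(x)'+R(x)-A(x)Q_0(x)C(x)'\big(I_M+C(x)Q_0(x)C(x)'\big)^{-1}C(x)Q_0(x)A(x)'$$ for all $x\in X$; and $$(1-p)^M\,(\det A(x))^2\,\frac{\det Q_0(x)}{\det Q_0(f(x))}<1\qquad\text{for Lebesgue almost all }x\in X.$$ -/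

import Mathlib

open MeasureTheory ProbabilityTheory
open scoped Matrix

noncomputable section

/-- Jacobian matrix of a map between Euclidean spaces: `(∂g_i/∂x_j)(x)`. -/
def jacobian {m n : Type*} [Fintype m] [Fintype n] [DecidableEq n]
    (g : EuclideanSpace ℝ n → EuclideanSpace ℝ m) (x : EuclideanSpace ℝ n) : Matrix m n ℝ :=
  Matrix.of fun i j => (fderiv ℝ g x (EuclideanSpace.single j 1)) i

/-- The observability map `θ(x) = (h(x), h(f(x)), …, h(f^{N-1}(x)))`, as one vector with
`N * M` coordinates. -/
def observabilityMap {N M : ℕ} (f : EuclideanSpace ℝ (Fin N) → EuclideanSpace ℝ (Fin N))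
    (h : EuclideanSpace ℝ (Fin N) → EuclideanSpace ℝ (Fin M))
    (x : EuclideanSpace ℝ (Fin N)) : EuclideanSpace ℝ (Fin N × Fin M) :=
  WithLp.toLp 2 fun k => (h (f^[(k.1 : ℕ)] x)) k.2

/-- `ξ 0, ξ 1, …` are independent Bernoulli variables with values in `{0, 1}` and
`Prob(ξ t = 1) = p`. -/
structure IsErasureProcess {Ω : Type*} [MeasurableSpace Ω] (μ : Measure Ω) (p : ℝ)
    (ξ : ℕ → Ω → ℝ) : Prop where
  measurable : ∀ t, Measurable (ξ t)
  zero_or_one : ∀ t ω, ξ t ω = 0 ∨ ξ t ω = 1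
  prob_one : ∀ t, μ {ω | ξ t ω = 1} = ENNReal.ofReal p
  indep : iIndepFun ξ μ

/-- The standing assumptions on `x_{t+1} = f(x_t)`, `y_t = ξ_t h(x_t)` with state space `X`.
`C^r` on `X` means `C^r` on an open neighbourhood of `X`, so that Jacobians make sense at every
point of `X`. -/
structure SystemAssumptions {N M : ℕ} (r : ℕ∞) (X : Set (EuclideanSpace ℝ (Fin N)))
    (f : EuclideanSpace ℝ (Fin N) → EuclideanSpace ℝ (Fin N))
    (h : EuclideanSpace ℝ (Fin N) → EuclideanSpace ℝ (Fin M)) : Prop where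
  /-- Every nonempty relatively open subset of `X` has positive Lebesgue measure. -/
  volume_ne_zero : ∀ V : Set (EuclideanSpace ℝ (Fin N)), IsOpen V → (X ∩ V).Nonempty →
    volume (X ∩ V) ≠ 0
  mapsTo : Set.MapsTo f X X
  smooth : ∃ U : Set (EuclideanSpace ℝ (Fin N)), IsOpen U ∧ X ⊆ U ∧
    ContDiffOn ℝ r f U ∧ ContDiffOn ℝ r h U
  zero_mem : (0 : EuclideanSpace ℝ (Fin N)) ∈ X
  f_zero : f 0 = 0
  h_zero : h 0 = 0
  /-- The Jacobian of `f` is uniformly bounded above and below. -/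
  jacobian_bounds : ∃ a₁ a₂ : ℝ, 0 < a₁ ∧ 0 < a₂ ∧ ∀ x ∈ X,
    ((jacobian f x)ᵀ * jacobian f x - a₁ • (1 : Matrix (Fin N) (Fin N) ℝ)).PosSemidef ∧
    (a₂ • (1 : Matrix (Fin N) (Fin N) ℝ) - (jacobian f x)ᵀ * jacobian f x).PosSemidef
  /-- The observability rank condition. -/
  observability_rank : ∀ x ∈ X, (jacobian (observabilityMap f h) x).rank = N
  /-- `α I < (∂θ/∂x)' (∂θ/∂x) < β I` on `X`. -/
  observability_bounds : ∃ α β : ℝ, 0 < α ∧ 0 < β ∧ ∀ x ∈ X,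
    ((jacobian (observabilityMap f h) x)ᵀ * jacobian (observabilityMap f h) x
      - α • (1 : Matrix (Fin N) (Fin N) ℝ)).PosDef ∧
    (β • (1 : Matrix (Fin N) (Fin N) ℝ)
      - (jacobian (observabilityMap f h) x)ᵀ * jacobian (observabilityMap f h) x).PosDef

/-- The assumptions on the deterministic observer gain `K`: of class `C^r` on a neighbourhood of
the outputs `h(X)`, zero at zero, and with derivative bounded on `h(X)`. -/
structure GainAssumptions {N M : ℕ} (r : ℕ∞) (X : Set (EuclideanSpace ℝ (Fin N)))
    (h : EuclideanSpace ℝ (Fin N) → EuclideanSpace ℝ (Fin M))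
    (K : EuclideanSpace ℝ (Fin M) → EuclideanSpace ℝ (Fin N)) : Prop where
  smooth : ∃ V : Set (EuclideanSpace ℝ (Fin M)), IsOpen V ∧ h '' X ⊆ V ∧ ContDiffOn ℝ r K V
  zero : K 0 = 0
  deriv_bounded : ∃ κ : ℝ, ∀ x ∈ X, ‖fderiv ℝ K (h x)‖ ≤ κ

/-- The linearized error dynamics along the orbit of `x₀`, for the erasure sequence `e`:
`η_{t+1} = (∂f/∂x(x_t) - e_t ∂(K ∘ h)/∂x(x_t)) η_t`, with `x_t = f^t(x₀)`. -/
def linearizedError {N M : ℕ} (f : EuclideanSpace ℝ (Fin N) → EuclideanSpace ℝ (Fin N))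
    (h : EuclideanSpace ℝ (Fin N) → EuclideanSpace ℝ (Fin M))
    (K : EuclideanSpace ℝ (Fin M) → EuclideanSpace ℝ (Fin N))
    (e : ℕ → ℝ) (x₀ η₀ : EuclideanSpace ℝ (Fin N)) : ℕ → EuclideanSpace ℝ (Fin N)
  | 0 => η₀
  | t + 1 => (fderiv ℝ f (f^[t] x₀) - e t • fderiv ℝ (K ∘ h) (f^[t] x₀))
      (linearizedError f h K e x₀ η₀ t)

/-- Mean square exponential stability of the linearized error dynamics: there are constants
`L < ∞` and `β < 1` with `E‖η_{t+1}‖² ≤ L β^t ‖η₀‖²` for all `t ≥ 0` and Lebesgue almost all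
initial conditions `x₀ ∈ X`, `η₀ ∈ ℝ^N`. -/
def IsMSEStable {N M : ℕ} {Ω : Type*} [MeasurableSpace Ω] (μ : Measure Ω) (ξ : ℕ → Ω → ℝ)
    (X : Set (EuclideanSpace ℝ (Fin N)))
    (f : EuclideanSpace ℝ (Fin N) → EuclideanSpace ℝ (Fin N))
    (h : EuclideanSpace ℝ (Fin N) → EuclideanSpace ℝ (Fin M))
    (K : EuclideanSpace ℝ (Fin M) → EuclideanSpace ℝ (Fin N)) : Prop :=
  ∃ L β : ℝ, 0 < L ∧ 0 < β ∧ β < 1 ∧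
    ∀ᵐ x₀ : EuclideanSpace ℝ (Fin N), x₀ ∈ X →
      ∀ᵐ η₀ : EuclideanSpace ℝ (Fin N), ∀ t : ℕ,
        ∫ ω, ‖linearizedError f h K (fun s => ξ s ω) x₀ η₀ (t + 1)‖ ^ 2 ∂μ
          ≤ L * β ^ t * ‖η₀‖ ^ 2

/-- The right-hand side of the Riccati equation,
`A Q A' + R - (A Q C') (I + C Q C')⁻¹ (C Q A')`. -/
def riccatiMap {N M : ℕ} (A : Matrix (Fin N) (Fin N) ℝ) (C : Matrix (Fin M) (Fin N) ℝ)
    (R Q : Matrix (Fin N) (Fin N) ℝ) : Matrix (Fin N) (Fin N) ℝ :=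
  A * Q * Aᵀ + R - (A * Q * Cᵀ) * (1 + C * Q * Cᵀ)⁻¹ * (C * Q * Aᵀ)

end

/-! Averaging over the erasures turns stability into a Lyapunov equation, whose solution `P` is
inverted to give `Q₀`. Write `G = K'(h(x)) C`, with `K'` the Jacobian of the gain. Conditioning on
one erasure at a time gives `E‖η_t‖² = ηᵀ W_t(x) η`, where `W_0 = 1` and `W_{t+1}(x) = (1-p) Aᵀ
W_t(f x) A + p (A-G)ᵀ W_t(f x) (A-G)`. Exponential stability, extended by continuity to every `x ∈
X`, makes `P = ∑ W_t` converge, with `1 ≤ P ≤ γ` and `P = 1 + (1-p) Aᵀ P(f x) A + p (A-G)ᵀ P(f x)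
(A-G)`.

Riccati equation: since `K'` is bounded, Young's inequality on the cross terms gives `Aᵀ P(f x) A ≤
P + c CᵀC` for a constant `c` (`PosSemidef.riccati_of_lyapunov`). Put `Q₀ = c P⁻¹`. By Woodbury the
Riccati map is `A (Q₀⁻¹ + CᵀC)⁻¹ Aᵀ + R`, so `R` is forced to be a deficit, and inverting the
inequality above shows that it is positive semidefinite.

Determinant: `G` has rank at most `M`, so the two branches agree on a subspace of codimension at
most `M`. Hence `P - 1` has determinant at least `(1-p)^M (det A)² det P(f x)`
(`pow_card_mul_det_le_det`). Also `P - 1 ≤ (1-γ⁻¹) P`, so `det (P - 1) < det P`. The scale `c`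
cancels in the quotient of determinants. -/

namespace Matrix

/-! ### Positive semidefinite real matrices and determinant bounds -/

theorem PosSemidef.transpose_eq {n : Type*} {P : Matrix n n ℝ} (hP : P.PosSemidef) : Pᵀ = P := by
  simpa [conjTranspose_eq_transpose_of_trivial] using hP.1.eq

variable {n m : Type*} [Fintype n] [Fintype m]

theorem PosSemidef.transpose_mul_mul {P : Matrix n n ℝ} (hP : P.PosSemidef) (B : Matrix n m ℝ) :
    (Bᵀ * P * B).PosSemidef := by
  simpa [conjTranspose_eq_transpose_of_trivial] using hP.conjTranspose_mul_mul_same B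

theorem PosSemidef.mul_mul_transpose {P : Matrix n n ℝ} (hP : P.PosSemidef) (B : Matrix m n ℝ) :
    (B * P * Bᵀ).PosSemidef := by
  simpa [conjTranspose_eq_transpose_of_trivial] using hP.mul_mul_conjTranspose_same B

theorem PosSemidef.quadForm_nonneg {P : Matrix n n ℝ} (hP : P.PosSemidef) (v : n → ℝ) :
    0 ≤ v ⬝ᵥ P *ᵥ v := by
  simpa using hP.dotProduct_mulVec_nonneg v

theorem posSemidef_of_quadForm_nonneg {P : Matrix n n ℝ} (hP : Pᵀ = P)
    (h : ∀ v, 0 ≤ v ⬝ᵥ P *ᵥ v) : P.PosSemidef :=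
  .of_dotProduct_mulVec_nonneg (by
    rw [IsHermitian, conjTranspose_eq_transpose_of_trivial, hP]) (by simpa using h)

variable [DecidableEq n]

open scoped MatrixOrder in
theorem PosSemidef.exists_eq_transpose_mul_self {P : Matrix n n ℝ} (hP : P.PosSemidef) :
    ∃ L : Matrix n n ℝ, P = Lᵀ * L := by
  obtain ⟨L, hL⟩ := CStarAlgebra.nonneg_iff_eq_star_mul_self.1 (Matrix.nonneg_iff_posSemidef.2 hP)
  exact ⟨L, by
    simpa [Matrix.star_eq_conjTranspose, Matrix.conjTranspose_eq_transpose_of_trivial] using hL⟩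

theorem one_le_det_of_one_le {H : Matrix n n ℝ} (hH : (H - 1).PosSemidef) : 1 ≤ H.det := by
  have hHerm : H.IsHermitian := by simpa using hH.1.add isHermitian_one
  rw [hHerm.det_eq_prod_eigenvalues]
  rw [← Finset.prod_const_one (s := Finset.univ (α := n))]
  refine Finset.prod_le_prod (fun _ _ => zero_le_one) fun i _ => ?_
  have h1 := hH.quadForm_nonneg (hHerm.eigenvectorBasis i).ofLp
  have h2 := hHerm.eigenvalues_eq i
  have h3 : (hHerm.eigenvectorBasis i).ofLp ⬝ᵥ (hHerm.eigenvectorBasis i).ofLp = 1 := by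
    have := real_inner_self_eq_norm_sq (hHerm.eigenvectorBasis i)
    rw [hHerm.eigenvectorBasis.norm_eq_one, one_pow,
      EuclideanSpace.inner_eq_star_dotProduct] at this
    exact this
  rw [sub_mulVec, dotProduct_sub, one_mulVec, h3] at h1
  simp only [star_trivial, RCLike.re_to_real] at h2
  simp only [RCLike.ofReal_real_eq_id, id]
  linarith

/-- Factor `X = LᵀL`; congruence by `L⁻¹` reduces to the case `X = 1`, where all eigenvalues of the
larger matrix are at least 1. -/
theorem det_le_det_of_sub_posSemidef {X Y : Matrix n n ℝ} (hX : X.PosDef)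
    (hXY : (Y - X).PosSemidef) : X.det ≤ Y.det := by
  obtain ⟨L, hL⟩ := hX.posSemidef.exists_eq_transpose_mul_self
  have hdet : X.det = L.det ^ 2 := by rw [hL, det_mul, det_transpose, sq]
  have hL0 : IsUnit L.det := by
    rw [isUnit_iff_ne_zero]
    intro h0
    have := hX.det_pos
    simp [hdet, h0] at this
  have hLT : IsUnit Lᵀ.det := by rwa [det_transpose]
  have h1 : L⁻¹ᵀ * Y * L⁻¹ - 1 = L⁻¹ᵀ * (Y - X) * L⁻¹ := by
    rw [Matrix.mul_sub, Matrix.sub_mul, hL, transpose_nonsing_inv,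
      nonsing_inv_mul_cancel_left _ _ hLT, mul_nonsing_inv _ hL0]
  have h2 : Y = Lᵀ * (L⁻¹ᵀ * Y * L⁻¹) * L := by
    rw [transpose_nonsing_inv, Matrix.mul_assoc Lᵀ⁻¹, mul_nonsing_inv_cancel_left _ _ hLT,
      nonsing_inv_mul_cancel_right _ _ hL0]
  have h3 := one_le_det_of_one_le (h1 ▸ hXY.transpose_mul_mul L⁻¹)
  rw [h2, det_mul, det_mul, det_transpose, hdet]
  nlinarith [sq_nonneg L.det]

/-- `J Jᵀ` is an orthogonal projection, so its complement equals its own Gram matrix. -/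
theorem one_sub_mul_transpose_posSemidef [DecidableEq m] {J : Matrix n m ℝ} (hJ : Jᵀ * J = 1) :
    (1 - J * Jᵀ).PosSemidef := by
  have h : 1 - J * Jᵀ = (1 - J * Jᵀ)ᵀ * 1 * (1 - J * Jᵀ) := by
    simp only [transpose_sub, transpose_mul, transpose_transpose, transpose_one, Matrix.mul_one]
    rw [Matrix.sub_mul, Matrix.mul_sub, Matrix.mul_sub, Matrix.mul_assoc J Jᵀ (J * Jᵀ),
      ← Matrix.mul_assoc Jᵀ J, hJ]
    simp
  rw [h]
  exact PosSemidef.one.transpose_mul_mul _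

/-- An orthonormal basis of the kernel of `V`, as the columns of a matrix. -/
theorem exists_orthonormal_kernel (V : Matrix m n ℝ) :
    ∃ (d : ℕ) (J : Matrix n (Fin d) ℝ),
      Fintype.card n ≤ Fintype.card m + d ∧ d ≤ Fintype.card n ∧ Jᵀ * J = 1 ∧ V * J = 0 := by
  let T := Matrix.toEuclideanLin V
  let b := stdOrthonormalBasis ℝ (LinearMap.ker T)
  refine ⟨_, Matrix.of fun i a => (b a : EuclideanSpace ℝ n) i, ?_, ?_, ?_, ?_⟩
  · have h1 := LinearMap.finrank_range_add_finrank_ker T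
    have h2 := Submodule.finrank_le (LinearMap.range T)
    simp only [finrank_euclideanSpace] at h1 h2
    omega
  · simpa using Submodule.finrank_le (LinearMap.ker T)
  · ext a c
    have h := orthonormal_iff_ite.1 b.orthonormal a c
    rw [Submodule.coe_inner, EuclideanSpace.inner_eq_star_dotProduct] at h
    rw [Matrix.one_apply, ← h]
    simp only [Matrix.mul_apply, dotProduct, transpose_apply, Matrix.of_apply, Pi.star_apply,
      star_trivial]
    exact Finset.sum_congr rfl fun _ _ => mul_comm _ _
  · ext i a
    have h : T (b a) = 0 := (b a).2
    have h' := congrArg (fun v : EuclideanSpace ℝ m => v i) h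
    exact h'

/-- `W = 1 - UV` fixes `ker V`, whose dimension `d` is at least `n - m`. Compressing `WᵀW` to `ZᵀZ`
with `Z = JᵀW` only lowers the determinant. Sylvester's identity then passes to size `d`, where `Z J
= 1` forces `Z Zᵀ ≥ 1`. -/
theorem pow_card_le_det_one_sub_mul {p : ℝ} (hp0 : 0 < p) (hp1 : p < 1) (U : Matrix n m ℝ)
    (V : Matrix m n ℝ) :
    (1 - p) ^ Fintype.card m ≤
      ((1 - p) • (1 : Matrix n n ℝ) + p • ((1 - U * V)ᵀ * (1 - U * V))).det := by
  obtain ⟨d, J, hcard, hd, hJ, hVJ⟩ := exists_orthonormal_kernel V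
  have hq : 0 < 1 - p := by linarith
  set W := 1 - U * V with hW
  have hWJ : W * J = J := by
    rw [hW, Matrix.sub_mul, Matrix.mul_assoc, hVJ]; simp
  set Z := Jᵀ * W with hZ
  have hZJ : Z * J = 1 := by rw [hZ, Matrix.mul_assoc, hWJ, hJ]
  have hPJ := one_sub_mul_transpose_posSemidef hJ
  set X : Matrix n n ℝ := (1 - p) • (1 + (p / (1 - p)) • (Zᵀ * Z)) with hX
  have hX' : X = (1 - p) • (1 : Matrix n n ℝ) + p • (Zᵀ * Z) := by
    rw [hX, smul_add, smul_smul, mul_div_cancel₀ _ hq.ne']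
  have hXpos : X.PosDef := by
    rw [hX']
    refine (PosDef.one.smul hq).add_posSemidef (PosSemidef.smul ?_ hp0.le)
    simpa using PosSemidef.one.transpose_mul_mul Z
  have hle : X.det ≤ ((1 - p) • (1 : Matrix n n ℝ) + p • (Wᵀ * W)).det := by
    refine det_le_det_of_sub_posSemidef hXpos ?_
    have : (1 - p) • (1 : Matrix n n ℝ) + p • (Wᵀ * W) - X = p • (Wᵀ * (1 - J * Jᵀ) * W) := by
      rw [hX', add_sub_add_left_eq_sub, ← smul_sub, hZ]
      simp only [transpose_mul, transpose_transpose, Matrix.mul_sub, Matrix.sub_mul,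
        Matrix.mul_one, Matrix.mul_assoc]
    rw [this]
    exact (hPJ.transpose_mul_mul W).smul hp0.le
  refine le_trans ?_ hle
  have hdetX : X.det = (1 - p) ^ Fintype.card n * (1 + (p / (1 - p)) • (Z * Zᵀ)).det := by
    rw [hX, det_smul, ← Matrix.smul_mul, det_one_add_mul_comm, Matrix.mul_smul]
  have hc : (1 : Matrix (Fin d) (Fin d) ℝ) + (p / (1 - p)) • (1 : Matrix (Fin d) (Fin d) ℝ)
      = (1 - p)⁻¹ • 1 := by
    nth_rw 1 [← one_smul ℝ (1 : Matrix (Fin d) (Fin d) ℝ)]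
    rw [← add_smul]
    congr 1
    field_simp
    ring
  have hdetZ : ((1 - p)⁻¹) ^ d ≤ (1 + (p / (1 - p)) • (Z * Zᵀ)).det := by
    have h1 : ((1 - p)⁻¹ • (1 : Matrix (Fin d) (Fin d) ℝ)).det = ((1 - p)⁻¹) ^ d := by
      rw [det_smul, det_one, Fintype.card_fin, mul_one]
    rw [← h1]
    refine det_le_det_of_sub_posSemidef (PosDef.one.smul (inv_pos.2 hq)) ?_
    have h2 : 1 + (p / (1 - p)) • (Z * Zᵀ) - (1 - p)⁻¹ • (1 : Matrix (Fin d) (Fin d) ℝ)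
        = (p / (1 - p)) • (Z * (1 - J * Jᵀ) * Zᵀ) := by
      have h3 : Z * (J * Jᵀ) * Zᵀ = 1 := by
        rw [← Matrix.mul_assoc, hZJ, Matrix.one_mul, ← transpose_mul, hZJ, transpose_one]
      rw [← hc, add_sub_add_left_eq_sub, ← smul_sub, Matrix.mul_sub, Matrix.sub_mul, h3,
        Matrix.mul_one]
    rw [h2]
    exact (hPJ.mul_mul_transpose Z).smul (div_nonneg hp0.le hq.le)
  -- The base lies in `(0, 1)` and `n - d ≤ m`, so the smaller exponent gives the larger power.
  calc (1 - p) ^ Fintype.card m ≤ (1 - p) ^ (Fintype.card n - d) :=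
        pow_le_pow_of_le_one hq.le (by linarith) (by omega)
    _ = (1 - p) ^ Fintype.card n * ((1 - p)⁻¹) ^ d := by
        rw [pow_sub₀ _ hq.ne' hd, inv_pow]
    _ ≤ X.det := by
        rw [hdetX]
        exact mul_le_mul_of_nonneg_left hdetZ (by positivity)

/-- With `P = LᵀL`, congruence by `T = L A` normalizes both `A` and `P` to the identity. -/
theorem pow_card_mul_det_le_det {p : ℝ} (hp0 : 0 < p) (hp1 : p < 1) {A P : Matrix n n ℝ}
    (hA : A.det ≠ 0) (hP : P.PosDef) (K : Matrix n m ℝ) (C : Matrix m n ℝ) :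
    (1 - p) ^ Fintype.card m * A.det ^ 2 * P.det ≤
      ((1 - p) • (Aᵀ * P * A) + p • ((A - K * C)ᵀ * P * (A - K * C))).det := by
  obtain ⟨L, rfl⟩ := hP.posSemidef.exists_eq_transpose_mul_self
  have hL0 : L.det ≠ 0 := by
    intro h0
    have := hP.det_pos
    simp [h0] at this
  set T := L * A with hT
  have hT0 : IsUnit T.det := by
    rw [isUnit_iff_ne_zero, hT, det_mul]; exact mul_ne_zero hL0 hA
  set W := 1 - (L * K) * (C * T⁻¹) with hW
  have hWT : W * T = L * (A - K * C) := by
    rw [hW, Matrix.sub_mul, Matrix.mul_assoc (L * K), Matrix.mul_assoc C, nonsing_inv_mul _ hT0]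
    simp [hT, Matrix.mul_sub, Matrix.mul_assoc]
  have hmain : (1 - p) • (Aᵀ * (Lᵀ * L) * A) + p • ((A - K * C)ᵀ * (Lᵀ * L) * (A - K * C))
      = Tᵀ * ((1 - p) • (1 : Matrix n n ℝ) + p • (Wᵀ * W)) * T := by
    have h1 : (A - K * C)ᵀ * (Lᵀ * L) * (A - K * C) = (W * T)ᵀ * (W * T) := by
      rw [hWT, transpose_mul]; simp only [Matrix.mul_assoc]
    rw [h1, hT]
    simp only [transpose_mul, Matrix.mul_add, Matrix.add_mul, Matrix.mul_smul, Matrix.smul_mul,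
      Matrix.mul_one, Matrix.mul_assoc]
  rw [hmain, det_mul Lᵀ, det_mul _ T, det_mul Tᵀ, det_transpose, det_transpose]
  have := pow_card_le_det_one_sub_mul hp0 hp1 (L * K) (C * T⁻¹)
  rw [← hW] at this
  calc (1 - p) ^ Fintype.card m * A.det ^ 2 * (L.det * L.det)
      = T.det ^ 2 * (1 - p) ^ Fintype.card m := by rw [hT, det_mul]; ring
    _ ≤ T.det ^ 2 * ((1 - p) • (1 : Matrix n n ℝ) + p • (Wᵀ * W)).det :=
        mul_le_mul_of_nonneg_left this (sq_nonneg _)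
    _ = _ := by ring

/-! ### Inversion in the Loewner order and the information form of the Riccati map -/

/-- If `Aᵀ T A ≤ S` then `A S⁻¹ Aᵀ ≤ T⁻¹`. -/
theorem inv_sub_mul_inv_mul_transpose_posSemidef [DecidableEq m] {S : Matrix n n ℝ} {T : Matrix m m ℝ}
    {A : Matrix m n ℝ} (hS : S.PosDef) (hT : T.PosDef) (h : (S - Aᵀ * T * A).PosSemidef) :
    (T⁻¹ - A * S⁻¹ * Aᵀ).PosSemidef := by
  have hSu : IsUnit S.det := isUnit_iff_ne_zero.2 hS.det_pos.ne'
  have hTu : IsUnit T.det := isUnit_iff_ne_zero.2 hT.det_pos.ne'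
  have hTi := hT.inv.posSemidef
  have hSi := hS.inv.posSemidef
  -- Completing the square writes the difference as a sum of two congruences of positive
  -- semidefinite matrices.
  have key : T⁻¹ - A * S⁻¹ * Aᵀ =
      (A * S⁻¹) * (S - Aᵀ * T * A) * (A * S⁻¹)ᵀ +
      (1 - A * S⁻¹ * Aᵀ * T) * T⁻¹ * (1 - A * S⁻¹ * Aᵀ * T)ᵀ := by
    simp only [transpose_mul, transpose_sub, transpose_one, transpose_transpose, hSi.transpose_eq,
      hT.posSemidef.transpose_eq, Matrix.mul_sub, Matrix.sub_mul, Matrix.mul_one, Matrix.one_mul,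
      Matrix.mul_assoc, nonsing_inv_mul_cancel_left _ _ hTu, nonsing_inv_mul_cancel_left _ _ hSu,
     mul_nonsing_inv _ hTu]
    abel
  rw [key]
  exact (h.mul_mul_transpose _).add (hTi.mul_mul_transpose _)

end Matrix

/-- The Woodbury identity applied to `(P + CᵀC)⁻¹`. -/
theorem riccatiMap_inv {N M : ℕ} (A : Matrix (Fin N) (Fin N) ℝ) (C : Matrix (Fin M) (Fin N) ℝ)
    (R : Matrix (Fin N) (Fin N) ℝ) {P : Matrix (Fin N) (Fin N) ℝ} (hP : P.PosDef) :
    riccatiMap A C R P⁻¹ = A * (P + Cᵀ * C)⁻¹ * Aᵀ + R := by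
  have hu : IsUnit (1 + C * P⁻¹ * Cᵀ) :=
    (Matrix.PosDef.one.add_posSemidef (hP.inv.posSemidef.mul_mul_transpose C)).isUnit
  have := Matrix.add_mul_mul_inv_eq_sub P Cᵀ 1 C hP.isUnit isUnit_one (by simpa using hu)
  rw [Matrix.mul_one, inv_one] at this
  rw [this, riccatiMap]
  simp only [Matrix.mul_sub, Matrix.sub_mul, Matrix.mul_assoc]
  abel

/-! ### The expected energy as a deterministic recursion -/

section MeanEnergy

variable {E : Type*} [NormedAddCommGroup E] [NormedSpace ℝ E]

/-- The expected energy `E‖η_t‖²` of `η_{t+1} = (A(x_t) - ξ_t B(x_t)) η_t`, `x_{t+1} = f(x_t)`, with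
`x_0 = x`, `η_0 = η` and independent `ξ_t ∈ {0, 1}` of mean `p`, by conditioning on `ξ_0`. -/
noncomputable def meanEnergy (p : ℝ) (f : E → E) (A B : E → E →L[ℝ] E) : ℕ → E → E → ℝ
  | 0, _, η => ‖η‖ ^ 2
  | t + 1, x, η => (1 - p) * meanEnergy p f A B t (f x) (A x η) +
      p * meanEnergy p f A B t (f x) ((A x - B x) η)

theorem continuous_meanEnergy (p : ℝ) (f : E → E) (A B : E → E →L[ℝ] E) (t : ℕ) (x : E) :
    Continuous (meanEnergy p f A B t x) := by
  induction t generalizing x with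
  | zero => exact continuous_norm.pow 2
  | succ t ih =>
    exact (((ih (f x)).comp (A x).continuous).const_mul _).add
      (((ih (f x)).comp (A x - B x).continuous).const_mul _)

theorem continuousOn_meanEnergy (p : ℝ) {f : E → E} {A B : E → E →L[ℝ] E} {X : Set E}
    (hf : ContinuousOn f X) (hfX : Set.MapsTo f X X) (hA : ContinuousOn A X)
    (hB : ContinuousOn B X) (t : ℕ) :
    ContinuousOn (fun z : E × E => meanEnergy p f A B t z.1 z.2) (X ×ˢ Set.univ) := by
  have h1 : Set.MapsTo (Prod.fst : E × E → E) (X ×ˢ Set.univ) X := fun z hz => hz.1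
  have hf1 : ContinuousOn (fun z : E × E => f z.1) (X ×ˢ Set.univ) :=
    hf.comp continuousOn_fst h1
  have hA1 : ContinuousOn (fun z : E × E => A z.1) (X ×ˢ Set.univ) := hA.comp continuousOn_fst h1
  have hB1 : ContinuousOn (fun z : E × E => B z.1) (X ×ˢ Set.univ) := hB.comp continuousOn_fst h1
  induction t with
  | zero => exact (continuous_snd.norm.pow 2).continuousOn
  | succ t ih =>
    have key : ∀ T : E → E →L[ℝ] E, ContinuousOn (fun z : E × E => T z.1) (X ×ˢ Set.univ) →
        ContinuousOn (fun z : E × E => meanEnergy p f A B t (f z.1) (T z.1 z.2))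
          (X ×ˢ Set.univ) := fun T hT =>
      ih.comp (hf1.prodMk (hT.clm_apply continuousOn_snd))
        fun z hz => ⟨hfX hz.1, Set.mem_univ _⟩
    exact ((key A hA1).const_mul _).add ((key (fun x => A x - B x) (hA1.sub hB1)).const_mul _)

end MeanEnergy

/-! ### Expected energy of the random error dynamics -/

section LinearizedError

variable {N M : ℕ} {Ω : Type*} [MeasurableSpace Ω] {μ : Measure Ω} {ξ : ℕ → Ω → ℝ} {p : ℝ}
  (f : EuclideanSpace ℝ (Fin N) → EuclideanSpace ℝ (Fin N))
  (h : EuclideanSpace ℝ (Fin N) → EuclideanSpace ℝ (Fin M))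
  (K : EuclideanSpace ℝ (Fin M) → EuclideanSpace ℝ (Fin N))

theorem linearizedError_congr {e e' : ℕ → ℝ} (x η : EuclideanSpace ℝ (Fin N)) {t : ℕ}
    (he : ∀ s < t, e s = e' s) :
    linearizedError f h K e x η t = linearizedError f h K e' x η t := by
  induction t with
  | zero => rfl
  | succ t ih =>
    simp only [linearizedError, he t t.lt_succ_self, ih fun s hs => he s (hs.trans t.lt_succ_self)]

theorem measurable_linearizedError {α : Type*} [MeasurableSpace α] {e : α → ℕ → ℝ}
    (he : ∀ s, Measurable fun a => e a s) (x η : EuclideanSpace ℝ (Fin N)) (t : ℕ) :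
    Measurable fun a => linearizedError f h K (e a) x η t := by
  induction t with
  | zero => exact measurable_const
  | succ t ih =>
    simp only [linearizedError, sub_apply, smul_apply]
    exact ((ContinuousLinearMap.measurable _).comp ih).sub
      ((he t).smul ((ContinuousLinearMap.measurable _).comp ih))

/-- Uniformity in the erasure sequence makes every continuous function of the error bounded, hence
integrable. -/
theorem exists_norm_linearizedError_le (x η : EuclideanSpace ℝ (Fin N)) (t : ℕ) :
    ∃ c : ℝ, ∀ e : ℕ → ℝ, (∀ s, e s = 0 ∨ e s = 1) → ‖linearizedError f h K e x η t‖ ≤ c := by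
  induction t with
  | zero => exact ⟨‖η‖, fun _ _ => le_rfl⟩
  | succ t ih =>
    obtain ⟨c, hc⟩ := ih
    refine ⟨(‖fderiv ℝ f (f^[t] x)‖ + ‖fderiv ℝ (K ∘ h) (f^[t] x)‖) * c, fun e he => ?_⟩
    refine (ContinuousLinearMap.le_opNorm _ _).trans
      (mul_le_mul ?_ (hc e he) (norm_nonneg _) (by positivity))
    refine (norm_sub_le _ _).trans (add_le_add_right ?_ _)
    rw [norm_smul]
    rcases he t with h0 | h1
    · simp [h0]
    · simp [h1]

namespace IsErasureProcess

variable {f h K}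

theorem integral_eq [IsProbabilityMeasure μ] (hξ : IsErasureProcess μ p ξ) (hp : 0 ≤ p) (t : ℕ) :
    ∫ ω, ξ t ω ∂μ = p := by
  have h1 : ξ t = Set.indicator {ω | ξ t ω = 1} 1 := by
    ext ω
    rcases hξ.zero_or_one t ω with h0 | h1
    · simp [Set.indicator, h0]
    · simp [Set.indicator, h1]
  have hm : MeasurableSet {ω | ξ t ω = 1} := hξ.measurable t (measurableSet_singleton 1)
  rw [h1, integral_indicator_one hm, Measure.real, hξ.prob_one, ENNReal.toReal_ofReal hp]

theorem indepFun_linearizedError (hξ : IsErasureProcess μ p ξ) (x η : EuclideanSpace ℝ (Fin N))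
    (t : ℕ) :
    IndepFun (ξ t) (fun ω => linearizedError f h K (fun s => ξ s ω) x η t) μ := by
  have hind := hξ.indep.indepFun_finset {t} (Finset.range t) (by simp) hξ.measurable
  -- The error at time `t` reads only `e s` with `s < t`, so the default value 0 is never used.
  let e : (Finset.range t → ℝ) → ℕ → ℝ := fun v s => if hs : s ∈ Finset.range t then v ⟨s, hs⟩ else 0
  have he : ∀ s, Measurable fun v => e v s := fun s => by
    by_cases hs : s ∈ Finset.range t
    · simpa only [e, hs, dite_true] using measurable_pi_apply _
    · simpa only [e, hs, dite_false] using measurable_const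
  have hφ : Measurable fun v : ({t} : Finset ℕ) → ℝ => v ⟨t, Finset.mem_singleton_self t⟩ :=
    measurable_pi_apply _
  have := hind.comp hφ (measurable_linearizedError f h K he x η t)
  have hY : (fun ω => linearizedError f h K (fun s => ξ s ω) x η t) =
      (fun v => linearizedError f h K (e v) x η t) ∘ fun ω (i : Finset.range t) => ξ i ω := by
    ext1 ω
    exact linearizedError_congr f h K x η fun s hs => by simp [e, hs]
  rw [hY]
  exact this

theorem integrable_comp_linearizedError [IsFiniteMeasure μ] (hξ : IsErasureProcess μ p ξ)
    (x η : EuclideanSpace ℝ (Fin N)) (t : ℕ) {g : EuclideanSpace ℝ (Fin N) → ℝ}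
    (hg : Continuous g) :
    Integrable (fun ω => g (linearizedError f h K (fun s => ξ s ω) x η t)) μ := by
  obtain ⟨c, hc⟩ := exists_norm_linearizedError_le f h K x η t
  obtain ⟨b, hb⟩ := (isCompact_closedBall (0 : EuclideanSpace ℝ (Fin N)) c).exists_bound_of_continuousOn
    hg.continuousOn
  refine Integrable.of_bound (hg.measurable.comp
    (measurable_linearizedError f h K hξ.measurable x η t)).aestronglyMeasurable b
    (.of_forall fun ω => hb _ ?_)
  simpa using hc _ fun s => hξ.zero_or_one s ω

/-- One step is exchanged between the random error and the averaged recursion: `ξ t` is independent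
of the error at time `t`, so it can be integrated out. Iterating moves all the randomness into
`meanEnergy`. -/
theorem integral_meanEnergy_succ [IsProbabilityMeasure μ] (hξ : IsErasureProcess μ p ξ)
    (hp : 0 ≤ p) (x η : EuclideanSpace ℝ (Fin N)) (s t : ℕ) :
    ∫ ω, meanEnergy p f (fderiv ℝ f) (fderiv ℝ (K ∘ h)) s (f^[t + 1] x)
        (linearizedError f h K (fun i => ξ i ω) x η (t + 1)) ∂μ =
      ∫ ω, meanEnergy p f (fderiv ℝ f) (fderiv ℝ (K ∘ h)) (s + 1) (f^[t] x)
        (linearizedError f h K (fun i => ξ i ω) x η t) ∂μ := by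
  set y := f^[t] x with hy
  set q := meanEnergy p f (fderiv ℝ f) (fderiv ℝ (K ∘ h)) s (f y) with hq
  have hqc : Continuous q := continuous_meanEnergy _ _ _ _ _ _
  set F : EuclideanSpace ℝ (Fin N) → ℝ := fun z => q (fderiv ℝ f y z) with hF
  set G : EuclideanSpace ℝ (Fin N) → ℝ :=
    fun z => q ((fderiv ℝ f y - fderiv ℝ (K ∘ h) y) z) with hG
  have hFc : Continuous F := hqc.comp (ContinuousLinearMap.continuous _)
  have hGc : Continuous G := hqc.comp (ContinuousLinearMap.continuous _)
  set Y : Ω → EuclideanSpace ℝ (Fin N) :=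
    fun ω => linearizedError f h K (fun i => ξ i ω) x η t with hY
  have hFi : Integrable (fun ω => F (Y ω)) μ := hξ.integrable_comp_linearizedError x η t hFc
  have hGi : Integrable (fun ω => G (Y ω)) μ := hξ.integrable_comp_linearizedError x η t hGc
  -- Since `ξ t` takes only the values 0 and 1, any function of the next error is affine in it.
  have hpt : ∀ ω, q (linearizedError f h K (fun i => ξ i ω) x η (t + 1)) =
      F (Y ω) + ξ t ω * (G (Y ω) - F (Y ω)) := by
    intro ω
    simp only [linearizedError, ← hy, hF, hG, hY]
    rcases hξ.zero_or_one t ω with h0 | h1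
    · simp [h0]
    · simp [h1]
  have hind : IndepFun (ξ t) (fun ω => G (Y ω) - F (Y ω)) μ :=
    (hξ.indepFun_linearizedError x η t).comp measurable_id (hGc.sub hFc).measurable
  have hprod := hind.integral_fun_mul_eq_mul_integral (hξ.measurable t).aestronglyMeasurable
    (hGi.sub hFi).aestronglyMeasurable
  have hint : Integrable (fun ω => ξ t ω * (G (Y ω) - F (Y ω))) μ := by
    refine (hGi.sub hFi).bdd_mul (c := 1) (hξ.measurable t).aestronglyMeasurable
      (.of_forall fun ω => ?_)
    rcases hξ.zero_or_one t ω with h0 | h1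
    · simp [h0]
    · simp [h1]
  rw [Function.iterate_succ_apply', ← hy]
  simp only [meanEnergy, ← hq, hpt]
  rw [integral_add hFi hint, hprod, hξ.integral_eq hp, integral_sub hGi hFi,
    integral_add (hFi.const_mul _) (hGi.const_mul _), integral_const_mul, integral_const_mul]
  ring

theorem integral_norm_sq_linearizedError [IsProbabilityMeasure μ] (hξ : IsErasureProcess μ p ξ)
    (hp : 0 ≤ p) (x η : EuclideanSpace ℝ (Fin N)) (t : ℕ) :
    ∫ ω, ‖linearizedError f h K (fun i => ξ i ω) x η t‖ ^ 2 ∂μ =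
      meanEnergy p f (fderiv ℝ f) (fderiv ℝ (K ∘ h)) t x η := by
  have key : ∀ s, ∫ ω, meanEnergy p f (fderiv ℝ f) (fderiv ℝ (K ∘ h)) s (f^[t] x)
      (linearizedError f h K (fun i => ξ i ω) x η t) ∂μ =
      meanEnergy p f (fderiv ℝ f) (fderiv ℝ (K ∘ h)) (s + t) x η := by
    induction t with
    | zero => intro s; simp [linearizedError]
    | succ t ih => intro s; rw [hξ.integral_meanEnergy_succ hp, ih]; congr 1; omega
  simpa [meanEnergy] using key 0

end IsErasureProcess

end LinearizedError

/-! ### The Lyapunov equation and its consequences -/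

namespace Matrix

variable {n m : Type*} [Fintype n] [Fintype m]

theorem dotProduct_transpose_mul_mul_mulVec (B : Matrix m n ℝ) (P : Matrix m m ℝ) (v : n → ℝ) :
    v ⬝ᵥ (Bᵀ * P * B) *ᵥ v = (B *ᵥ v) ⬝ᵥ P *ᵥ (B *ᵥ v) := by
  rw [Matrix.mul_assoc, ← mulVec_mulVec, ← mulVec_mulVec, dotProduct_mulVec, vecMul_transpose]

variable [DecidableEq n]

/-- Evaluate the form at `e_i ± e_j`; diagonal entries are at most `b`. This turns bounds on forms
into entrywise summability. -/
theorem PosSemidef.abs_apply_le {P : Matrix n n ℝ} (hP : P.PosSemidef) {b : ℝ}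
    (hb : ∀ v : n → ℝ, v ⬝ᵥ P *ᵥ v ≤ b * (v ⬝ᵥ v)) (i j : n) : |P i j| ≤ b := by
  have hdiag : ∀ k, P k k ≤ b := fun k => by
    simpa using hb (Pi.single k 1)
  have hsymm : P j i = P i j := congrFun (congrFun hP.transpose_eq i) j
  have h1 := hP.quadForm_nonneg (Pi.single i 1 + Pi.single j 1)
  have h2 := hP.quadForm_nonneg (Pi.single i 1 - Pi.single j 1)
  simp [mulVec_add, mulVec_sub, dotProduct_add, dotProduct_sub, add_dotProduct,
    sub_dotProduct] at h1 h2
  rw [abs_le]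
  constructor <;> linarith [hdiag i, hdiag j]

/-- A solution `P` of the Lyapunov equation with gain `K` satisfies the information form of the
Riccati inequality after adding a multiple of `Cᵀ C`. -/
theorem PosSemidef.riccati_of_lyapunov {p a γ k : ℝ} (hp0 : 0 < p) (hp1 : p < 1) (ha : 0 < a)
    (hγ : 0 < γ) (hk : 0 ≤ k) [DecidableEq m] {A P P' : Matrix n n ℝ}
    {K : Matrix n m ℝ} {C : Matrix m n ℝ}
    (hP : P = 1 + ((1 - p) • (Aᵀ * P' * A) + p • ((A - K * C)ᵀ * P' * (A - K * C))))
    (hP' : P'.PosSemidef) (hP'γ : (γ • (1 : Matrix n n ℝ) - P').PosSemidef)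
    (hA : (a • (1 : Matrix n n ℝ) - Aᵀ * A).PosSemidef)
    (hK : (k • (1 : Matrix m m ℝ) - Kᵀ * K).PosSemidef) :
    (P + (γ ^ 2 * a * k + 1) • (Cᵀ * C) - Aᵀ * P' * A).PosSemidef := by
  have hs : 0 < γ * a := mul_pos hγ ha
  set s := γ * a with hs_def
  have h1 : ((p / s) • ((A - s • (K * C))ᵀ * P' * (A - s • (K * C)))).PosSemidef :=
    (hP'.transpose_mul_mul _).smul (by positivity)
  have h2 : ((p / s) • (Aᵀ * (γ • (1 : Matrix n n ℝ) - P') * A +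
      γ • (a • (1 : Matrix n n ℝ) - Aᵀ * A))).PosSemidef :=
    ((hP'γ.transpose_mul_mul _).add (hA.smul hγ.le)).smul (by positivity)
  have h3 : (p • ((K * C)ᵀ * P' * (K * C))).PosSemidef :=
    (hP'.transpose_mul_mul _).smul hp0.le
  have h4 : ((p * s) • ((K * C)ᵀ * (γ • (1 : Matrix n n ℝ) - P') * (K * C) +
      γ • (Cᵀ * (k • (1 : Matrix m m ℝ) - Kᵀ * K) * C))).PosSemidef :=
    ((hP'γ.transpose_mul_mul _).add ((hK.transpose_mul_mul _).smul hγ.le)).smul (by positivity)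
  have h5 : (((1 - p) * (γ ^ 2 * a * k) + 1) • (Cᵀ * C)).PosSemidef := by
    refine PosSemidef.smul (by simpa using PosSemidef.one.transpose_mul_mul C) ?_
    have : 0 ≤ 1 - p := by linarith
    positivity
  have h6 : ((1 - p) • (1 : Matrix n n ℝ)).PosSemidef := PosSemidef.one.smul (by linarith)
  -- Young's inequality with weight `s = γa` on the cross terms of `A` and `KC`. The `A` part costs
  -- at most `p • 1`, paid by the summand 1 of `P`. The `KC` part costs at most `pγ²ak • CᵀC`. The
  -- remaining terms are the slack.
  have key : P + (γ ^ 2 * a * k + 1) • (Cᵀ * C) - Aᵀ * P' * A =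
      (p / s) • ((A - s • (K * C))ᵀ * P' * (A - s • (K * C))) +
      (p / s) • (Aᵀ * (γ • (1 : Matrix n n ℝ) - P') * A + γ • (a • (1 : Matrix n n ℝ) - Aᵀ * A)) +
      p • ((K * C)ᵀ * P' * (K * C)) +
      (p * s) • ((K * C)ᵀ * (γ • (1 : Matrix n n ℝ) - P') * (K * C) +
        γ • (Cᵀ * (k • (1 : Matrix m m ℝ) - Kᵀ * K) * C)) +
      ((1 - p) * (γ ^ 2 * a * k) + 1) • (Cᵀ * C) + (1 - p) • (1 : Matrix n n ℝ) := by
    rw [hP]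
    simp only [transpose_sub, transpose_mul, transpose_smul, Matrix.mul_sub, Matrix.sub_mul,
      Matrix.mul_smul, Matrix.smul_mul, Matrix.mul_one, Matrix.mul_assoc]
    match_scalars <;> field_simp <;> simp only [hs_def] <;> ring
  rw [key]
  exact ((((h1.add h2).add h3).add h4).add h5).add h6

theorem PosDef.transpose_mul_mul {P : Matrix n n ℝ} (hP : P.PosDef) {A : Matrix n n ℝ}
    (hA : A.det ≠ 0) : (Aᵀ * P * A).PosDef := by
  have hinj : Function.Injective A.mulVec :=
    mulVec_injective_of_isUnit ((isUnit_iff_isUnit_det A).2 (isUnit_iff_ne_zero.2 hA))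
  simpa [conjTranspose_eq_transpose_of_trivial] using hP.conjTranspose_mul_mul_same hinj

/-- `Z = P - 1` and `P ≤ γ` give `Z ≤ (1 - γ⁻¹) P`; `Nonempty n` makes the resulting factor `(1 -
γ⁻¹)^n` strictly less than 1. -/
theorem det_lt_of_lyapunov [Nonempty n] {p γ : ℝ} (hp0 : 0 < p) (hp1 : p < 1) (hγ : 1 ≤ γ)
    {A P P' : Matrix n n ℝ} {K : Matrix n m ℝ} {C : Matrix m n ℝ}
    (hP : P = 1 + ((1 - p) • (Aᵀ * P' * A) + p • ((A - K * C)ᵀ * P' * (A - K * C))))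
    (hPpos : P.PosDef) (hP' : P'.PosDef) (hPγ : (γ • (1 : Matrix n n ℝ) - P).PosSemidef)
    (hA : A.det ≠ 0) : (1 - p) ^ Fintype.card m * A.det ^ 2 * P'.det < P.det := by
  set Z := (1 - p) • (Aᵀ * P' * A) + p • ((A - K * C)ᵀ * P' * (A - K * C)) with hZ
  have hγ0 : 0 < γ := by linarith
  have hZpos : Z.PosDef := ((hP'.transpose_mul_mul hA).smul (by linarith)).add_posSemidef
    ((hP'.posSemidef.transpose_mul_mul _).smul hp0.le)
  have h1 : Z.det ≤ ((1 - γ⁻¹) • P).det := by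
    refine det_le_det_of_sub_posSemidef hZpos ?_
    have : (1 - γ⁻¹) • P - Z = γ⁻¹ • (γ • (1 : Matrix n n ℝ) - P) := by
      rw [eq_sub_of_add_eq' hP.symm]
      match_scalars <;> field_simp
      ring
    rw [this]
    exact hPγ.smul (by positivity)
  have h2 : (1 - γ⁻¹) ^ Fintype.card n < 1 := by
    refine pow_lt_one₀ ?_ ?_ Fintype.card_ne_zero
    · linarith [inv_le_one_of_one_le₀ hγ]
    · linarith [inv_pos.2 hγ0]
  calc _ ≤ Z.det := pow_card_mul_det_le_det hp0 hp1 hA hP' K C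
    _ ≤ (1 - γ⁻¹) ^ Fintype.card n * P.det := by rwa [det_smul] at h1
    _ < P.det := by nlinarith [hPpos.det_pos]

/-- The series solution of a Lyapunov-type recursion `W (t + 1) x = Φ_x (W t (f x))`. -/
theorem exists_lyapunov_solution {E : Type*} {f : E → E} {X : Set E} (hf : Set.MapsTo f X X)
    {p L β : ℝ} (hβ0 : 0 < β) (hβ1 : β < 1) {A G : E → Matrix n n ℝ} {W : ℕ → E → Matrix n n ℝ}
    (hW0 : ∀ x, W 0 x = 1)
    (hW : ∀ t x, W (t + 1) x =
      (1 - p) • ((A x)ᵀ * W t (f x) * A x) + p • ((A x - G x)ᵀ * W t (f x) * (A x - G x)))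
    (hpos : ∀ t x, (W t x).PosSemidef)
    (hbound : ∀ x ∈ X, ∀ t v, v ⬝ᵥ W (t + 1) x *ᵥ v ≤ L * β ^ t * (v ⬝ᵥ v)) :
    ∃ P : E → Matrix n n ℝ, ∀ x ∈ X, (P x - 1).PosSemidef ∧
      ((1 + L / (1 - β)) • (1 : Matrix n n ℝ) - P x).PosSemidef ∧
      P x = 1 + ((1 - p) • ((A x)ᵀ * P (f x) * A x) +
        p • ((A x - G x)ᵀ * P (f x) * (A x - G x))) := by
  have hgeom : HasSum (fun t => L * β ^ t) (L / (1 - β)) := by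
    simpa [div_eq_mul_inv] using (hasSum_geometric_of_lt_one hβ0.le hβ1).mul_left L
  have hsum : ∀ x ∈ X, Summable fun t => W t x := by
    intro x hx
    refine Pi.summable.2 fun i => Pi.summable.2 fun j => (summable_nat_add_iff 1).1 ?_
    exact hgeom.summable.of_norm_bounded fun t => (hpos (t + 1) x).abs_apply_le (hbound x hx t) i j
  -- The decay bound starts at index 1; the term `W 0 = 1` is split off and becomes the
  -- inhomogeneous term of the equation.
  have hshift : ∀ x ∈ X, HasSum (fun t => W (t + 1) x) ((∑' t, W t x) - 1) := by
    intro x hx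
    have := (hasSum_nat_add_iff' 1).2 (hsum x hx).hasSum
    simpa [hW0] using this
  have hquad : ∀ v : n → ℝ, ∀ x ∈ X,
      HasSum (fun t => v ⬝ᵥ W (t + 1) x *ᵥ v) (v ⬝ᵥ ((∑' t, W t x) - 1) *ᵥ v) := by
    intro v x hx
    let g : Matrix n n ℝ →+ ℝ :=
      { toFun := fun S => v ⬝ᵥ S *ᵥ v
        map_zero' := by simp
        map_add' := fun S T => by simp [add_mulVec, dotProduct_add] }
    have hg : Continuous g :=
      continuous_const.dotProduct (continuous_id.matrix_mulVec continuous_const)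
    exact (hshift x hx).map g hg
  have hsymm : ∀ x ∈ X, ((∑' t, W t x) - 1)ᵀ = (∑' t, W t x) - 1 := fun x hx => by
    have := (hshift x hx).matrix_transpose
    simp only [(hpos _ _).transpose_eq] at this
    exact this.unique (hshift x hx)
  refine ⟨fun x => ∑' t, W t x, fun x hx => ⟨?_, ?_, ?_⟩⟩
  · exact posSemidef_of_quadForm_nonneg (hsymm x hx) fun v =>
      (hquad v x hx).nonneg fun t => (hpos _ _).quadForm_nonneg v
  · have heq : (1 + L / (1 - β)) • (1 : Matrix n n ℝ) - ∑' t, W t x =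
        (L / (1 - β)) • (1 : Matrix n n ℝ) - ((∑' t, W t x) - 1) := by
      rw [add_smul, one_smul]; abel
    rw [heq]
    refine posSemidef_of_quadForm_nonneg ?_ fun v => ?_
    · rw [transpose_sub, hsymm x hx, transpose_smul, transpose_one]
    · have := hasSum_le (hbound x hx · v) (hquad v x hx) (hgeom.mul_right (v ⬝ᵥ v))
      rw [sub_mulVec, dotProduct_sub, smul_mulVec, dotProduct_smul, one_mulVec, smul_eq_mul]
      linarith
  · let g : Matrix n n ℝ →+ Matrix n n ℝ :=
      { toFun := fun S => (1 - p) • ((A x)ᵀ * S * A x) + p • ((A x - G x)ᵀ * S * (A x - G x))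
        map_zero' := by simp
        map_add' := fun S T => by
          simp only [Matrix.mul_add, Matrix.add_mul, smul_add]; abel }
    have hg : Continuous g := by
      change Continuous fun S : Matrix n n ℝ =>
        (1 - p) • ((A x)ᵀ * S * A x) + p • ((A x - G x)ᵀ * S * (A x - G x))
      fun_prop
    have h1 := (hsum (f x) (hf hx)).hasSum.map g hg
    have h2 : (fun t => W (t + 1) x) = g ∘ fun t => W t (f x) := by
      ext1 t; exact hW t x
    exact (sub_eq_iff_eq_add'.1 ((hshift x hx).unique (h2 ▸ h1)))

end Matrix

/-! ### Jacobian matrices and the energy as a quadratic form -/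

section Jacobian

variable {l m n : Type*} [Fintype l] [Fintype m] [Fintype n]

theorem EuclideanSpace.dotProduct_self_eq_norm_sq (v : EuclideanSpace ℝ n) :
    v.ofLp ⬝ᵥ v.ofLp = ‖v‖ ^ 2 := by
  rw [← real_inner_self_eq_norm_sq, EuclideanSpace.inner_eq_star_dotProduct]
  rfl

variable [DecidableEq n]

theorem jacobian_mulVec (g : EuclideanSpace ℝ n → EuclideanSpace ℝ m) (x v : EuclideanSpace ℝ n) :
    jacobian g x *ᵥ v.ofLp = (fderiv ℝ g x v).ofLp := by
  ext i
  have hv : v = ∑ j, v j • EuclideanSpace.single j (1 : ℝ) := by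
    ext k
    simp [Pi.single_apply]
  conv_rhs => rw [hv, map_sum]
  simp [jacobian, Matrix.mulVec, dotProduct, mul_comm]

theorem jacobian_comp [DecidableEq m] {K : EuclideanSpace ℝ m → EuclideanSpace ℝ l}
    {h : EuclideanSpace ℝ n → EuclideanSpace ℝ m} {x : EuclideanSpace ℝ n}
    (hK : DifferentiableAt ℝ K (h x)) (hh : DifferentiableAt ℝ h x) :
    jacobian (K ∘ h) x = jacobian K (h x) * jacobian h x := by
  ext i j
  have h1 := congrFun (jacobian_mulVec K (h x) (fderiv ℝ h x (EuclideanSpace.single j 1))) i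
  rw [jacobian, Matrix.of_apply, fderiv_comp x hK hh]
  exact h1.symm

theorem sq_smul_one_sub_jacobian_posSemidef [DecidableEq m]
    {g : EuclideanSpace ℝ n → EuclideanSpace ℝ m}
    {x : EuclideanSpace ℝ n} {κ : ℝ} (hκ : ‖fderiv ℝ g x‖ ≤ κ) :
    (κ ^ 2 • (1 : Matrix n n ℝ) - (jacobian g x)ᵀ * jacobian g x).PosSemidef := by
  refine Matrix.posSemidef_of_quadForm_nonneg (by simp) fun v => ?_
  obtain ⟨v, rfl⟩ : ∃ w : EuclideanSpace ℝ n, w.ofLp = v := ⟨WithLp.toLp 2 v, rfl⟩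
  have h1 := Matrix.dotProduct_transpose_mul_mul_mulVec (jacobian g x) 1 v.ofLp
  rw [Matrix.mul_one, Matrix.one_mulVec, jacobian_mulVec,
    EuclideanSpace.dotProduct_self_eq_norm_sq] at h1
  rw [Matrix.sub_mulVec, dotProduct_sub, Matrix.smul_mulVec, dotProduct_smul, Matrix.one_mulVec,
    smul_eq_mul, h1, EuclideanSpace.dotProduct_self_eq_norm_sq, ← mul_pow, sub_nonneg]
  exact pow_le_pow_left₀ (norm_nonneg _) ((fderiv ℝ g x).le_of_opNorm_le hκ v) 2

/-- The matrix of the quadratic form `meanEnergy`. -/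
noncomputable def energyMatrix (p : ℝ) (f : EuclideanSpace ℝ n → EuclideanSpace ℝ n)
    (A G : EuclideanSpace ℝ n → Matrix n n ℝ) : ℕ → EuclideanSpace ℝ n → Matrix n n ℝ
  | 0, _ => 1
  | t + 1, x => (1 - p) • ((A x)ᵀ * energyMatrix p f A G t (f x) * A x) +
      p • ((A x - G x)ᵀ * energyMatrix p f A G t (f x) * (A x - G x))

theorem posSemidef_energyMatrix {p : ℝ} (hp0 : 0 ≤ p) (hp1 : p ≤ 1)
    (f : EuclideanSpace ℝ n → EuclideanSpace ℝ n) (A G : EuclideanSpace ℝ n → Matrix n n ℝ)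
    (t : ℕ) (x : EuclideanSpace ℝ n) : (energyMatrix p f A G t x).PosSemidef := by
  induction t generalizing x with
  | zero => exact .one
  | succ t ih =>
    exact (((ih _).transpose_mul_mul _).smul (sub_nonneg.2 hp1)).add
      (((ih _).transpose_mul_mul _).smul hp0)

theorem quadForm_energyMatrix (p : ℝ) (f g : EuclideanSpace ℝ n → EuclideanSpace ℝ n) (t : ℕ)
    (x v : EuclideanSpace ℝ n) :
    v.ofLp ⬝ᵥ energyMatrix p f (jacobian f) (jacobian g) t x *ᵥ v.ofLp =
      meanEnergy p f (fderiv ℝ f) (fderiv ℝ g) t x v := by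
  induction t generalizing x v with
  | zero => simp [energyMatrix, meanEnergy, EuclideanSpace.dotProduct_self_eq_norm_sq]
  | succ t ih =>
    rw [energyMatrix, meanEnergy, Matrix.add_mulVec, dotProduct_add, Matrix.smul_mulVec,
      Matrix.smul_mulVec, dotProduct_smul, dotProduct_smul,
      Matrix.dotProduct_transpose_mul_mul_mulVec, Matrix.dotProduct_transpose_mul_mul_mulVec,
      Matrix.sub_mulVec, jacobian_mulVec, jacobian_mulVec, ← ih, ← ih]
    rfl

end Jacobian

/-! ### From the system assumptions to a bounded Lyapunov solution -/

/-- The exceptional set in `X` is null, so it cannot contain a nonempty relatively open subset of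
`X`. -/
theorem frequently_nhds_of_ae {E : Type*} [TopologicalSpace E] [MeasurableSpace E] {μ : Measure E}
    {X : Set E} (hX : ∀ V : Set E, IsOpen V → (X ∩ V).Nonempty → μ (X ∩ V) ≠ 0) {P : E → Prop}
    (hP : ∀ᵐ x ∂μ, x ∈ X → P x) {x : E} (hx : x ∈ X) : ∃ᶠ y in nhdsWithin x X, P y := by
  intro hn
  obtain ⟨V, hV, hxV, hVP⟩ := mem_nhdsWithin.1 hn
  refine hX V hV ⟨x, hx, hxV⟩ (measure_mono_null (fun y hy => ?_) (ae_iff.1 hP))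
  exact fun h => hVP ⟨hy.2, hy.1⟩ (h hy.1)

section System

variable {N M : ℕ} {r : ℕ∞} {X : Set (EuclideanSpace ℝ (Fin N))}
  {f : EuclideanSpace ℝ (Fin N) → EuclideanSpace ℝ (Fin N)}
  {h : EuclideanSpace ℝ (Fin N) → EuclideanSpace ℝ (Fin M)}
  {K : EuclideanSpace ℝ (Fin M) → EuclideanSpace ℝ (Fin N)}

theorem SystemAssumptions.contDiffOn_comp (hsys : SystemAssumptions r X f h)
    (hK : GainAssumptions r X h K) :
    ∃ U : Set (EuclideanSpace ℝ (Fin N)), IsOpen U ∧ X ⊆ U ∧ ContDiffOn ℝ r (K ∘ h) U := by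
  obtain ⟨U, hU, hXU, -, hh⟩ := hsys.smooth
  obtain ⟨V, hV, hXV, hKV⟩ := hK.smooth
  exact ⟨U ∩ h ⁻¹' V, hh.continuousOn.isOpen_inter_preimage hU hV,
    fun x hx => ⟨hXU hx, hXV ⟨x, hx, rfl⟩⟩,
    hKV.comp (hh.mono Set.inter_subset_left) fun x hx => hx.2⟩

theorem SystemAssumptions.jacobian_comp_eq (hsys : SystemAssumptions r X f h)
    (hK : GainAssumptions r X h K) (hr : 1 ≤ r) {x : EuclideanSpace ℝ (Fin N)} (hx : x ∈ X) :
    jacobian (K ∘ h) x = jacobian K (h x) * jacobian h x := by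
  obtain ⟨U, hU, hXU, -, hh⟩ := hsys.smooth
  obtain ⟨V, hV, hXV, hKV⟩ := hK.smooth
  have hr0 : (r : WithTop ℕ∞) ≠ 0 := by
    have : r ≠ 0 := (zero_lt_one.trans_le hr).ne'
    exact_mod_cast this
  exact jacobian_comp
    ((hKV.differentiableOn hr0).differentiableAt (hV.mem_nhds (hXV ⟨x, hx, rfl⟩)))
    ((hh.differentiableOn hr0).differentiableAt (hU.mem_nhds (hXU hx)))

/-- Mean square exponential stability holds for every initial condition, by continuity. -/
theorem SystemAssumptions.meanEnergy_le (hsys : SystemAssumptions r X f h)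
    (hK : GainAssumptions r X h K) (hr : 1 ≤ r) {p : ℝ} (hp : 0 ≤ p)
    {Ω : Type*} [MeasurableSpace Ω] {μ : Measure Ω} [IsProbabilityMeasure μ] {ξ : ℕ → Ω → ℝ}
    (hξ : IsErasureProcess μ p ξ) (hstab : IsMSEStable μ ξ X f h K) :
    ∃ L β : ℝ, 0 < L ∧ 0 < β ∧ β < 1 ∧ ∀ x ∈ X, ∀ t η,
      meanEnergy p f (fderiv ℝ f) (fderiv ℝ (K ∘ h)) (t + 1) x η ≤ L * β ^ t * ‖η‖ ^ 2 := by
  obtain ⟨L, β, hL, hβ0, hβ1, hae⟩ := hstab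
  simp only [hξ.integral_norm_sq_linearizedError hp] at hae
  have hr1 : (1 : WithTop ℕ∞) ≤ r := by exact_mod_cast hr
  refine ⟨L, β, hL, hβ0, hβ1, fun x hx t η => ?_⟩
  have hae' : ∀ᵐ y : EuclideanSpace ℝ (Fin N), y ∈ X →
      meanEnergy p f (fderiv ℝ f) (fderiv ℝ (K ∘ h)) (t + 1) y η ≤ L * β ^ t * ‖η‖ ^ 2 := by
    filter_upwards [hae] with y hy hyX
    have hclosed : IsClosed {ζ : EuclideanSpace ℝ (Fin N) |
        meanEnergy p f (fderiv ℝ f) (fderiv ℝ (K ∘ h)) (t + 1) y ζ ≤ L * β ^ t * ‖ζ‖ ^ 2} :=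
      isClosed_le (continuous_meanEnergy _ _ _ _ _ _)
        (continuous_const.mul (continuous_norm.pow 2))
    -- For fixed `y` the inequality is closed in the initial error and holds on a set of full
    -- measure, which is dense.
    have hdense := Measure.dense_of_ae ((hy hyX).mono fun ζ hζ => hζ t)
    have huniv := hclosed.closure_eq ▸ hdense.closure_eq
    exact huniv.ge (Set.mem_univ η)
  obtain ⟨U, hU, hXU, hf, -⟩ := hsys.smooth
  obtain ⟨U', hU', hXU', hKh⟩ := hsys.contDiffOn_comp hK
  have hcont : ContinuousOn
      (fun y => meanEnergy p f (fderiv ℝ f) (fderiv ℝ (K ∘ h)) (t + 1) y η) X :=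
    (continuousOn_meanEnergy p (hf.continuousOn.mono hXU) hsys.mapsTo
      ((hf.continuousOn_fderiv_of_isOpen hU hr1).mono hXU)
      ((hKh.continuousOn_fderiv_of_isOpen hU' hr1).mono hXU') (t + 1)).comp
      (continuousOn_id.prodMk continuousOn_const) fun y hy => ⟨hy, Set.mem_univ _⟩
  exact le_of_tendsto_of_frequently (hcont x hx)
    (frequently_nhds_of_ae hsys.volume_ne_zero hae' hx)

theorem SystemAssumptions.det_jacobian_ne_zero (hsys : SystemAssumptions r X f h)
    {x : EuclideanSpace ℝ (Fin N)} (hx : x ∈ X) : (jacobian f x).det ≠ 0 := by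
  obtain ⟨a₁, a₂, ha₁, -, hb⟩ := hsys.jacobian_bounds
  have h1 := ((Matrix.PosDef.one.smul ha₁).add_posSemidef (hb x hx).1).det_pos
  rw [add_sub_cancel, Matrix.det_mul, Matrix.det_transpose] at h1
  exact fun h0 => by simp [h0] at h1

/-- A bounded solution of the Lyapunov equation of the linearized error dynamics. -/
theorem SystemAssumptions.exists_lyapunov_solution (hsys : SystemAssumptions r X f h)
    (hK : GainAssumptions r X h K) (hr : 1 ≤ r) {p : ℝ} (hp0 : 0 ≤ p) (hp1 : p ≤ 1)
    {Ω : Type*} [MeasurableSpace Ω] {μ : Measure Ω} [IsProbabilityMeasure μ] {ξ : ℕ → Ω → ℝ}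
    (hξ : IsErasureProcess μ p ξ) (hstab : IsMSEStable μ ξ X f h K) :
    ∃ (γ : ℝ) (P : EuclideanSpace ℝ (Fin N) → Matrix (Fin N) (Fin N) ℝ), 1 ≤ γ ∧ ∀ x ∈ X,
      (P x - 1).PosSemidef ∧ (γ • (1 : Matrix (Fin N) (Fin N) ℝ) - P x).PosSemidef ∧
      P x = 1 + ((1 - p) • ((jacobian f x)ᵀ * P (f x) * jacobian f x) +
        p • ((jacobian f x - jacobian K (h x) * jacobian h x)ᵀ * P (f x) *
          (jacobian f x - jacobian K (h x) * jacobian h x))) := by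
  obtain ⟨L, β, hL, hβ0, hβ1, hle⟩ := hsys.meanEnergy_le hK hr hp0 hξ hstab
  obtain ⟨P, hP⟩ := Matrix.exists_lyapunov_solution hsys.mapsTo (p := p) (L := L) hβ0 hβ1
    (W := energyMatrix p f (jacobian f) (jacobian (K ∘ h))) (fun _ => rfl) (fun _ _ => rfl)
    (posSemidef_energyMatrix hp0 hp1 _ _ _) fun x hx t v => by
      have := hle x hx t (WithLp.toLp 2 v)
      rwa [← quadForm_energyMatrix, ← EuclideanSpace.dotProduct_self_eq_norm_sq] at this
  have : 0 < L / (1 - β) := div_pos hL (sub_pos.2 hβ1)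
  refine ⟨1 + L / (1 - β), P, by linarith, fun x hx => ?_⟩
  rw [← hsys.jacobian_comp_eq hK hr hx]
  exact hP x hx

end System

/-! ### Construction of the Riccati solution -/

theorem mainTheorem5 {N M : ℕ} (hMN : M < N) (r : ℕ∞) (hr : 1 ≤ r)
    (X : Set (EuclideanSpace ℝ (Fin N)))
    (f : EuclideanSpace ℝ (Fin N) → EuclideanSpace ℝ (Fin N))
    (h : EuclideanSpace ℝ (Fin N) → EuclideanSpace ℝ (Fin M))
    (K : EuclideanSpace ℝ (Fin M) → EuclideanSpace ℝ (Fin N))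
    (hsys : SystemAssumptions r X f h) (hK : GainAssumptions r X h K)
    (p : ℝ) (hp0 : 0 < p) (hp1 : p < 1)
    {Ω : Type*} [MeasurableSpace Ω] (μ : Measure Ω) [IsProbabilityMeasure μ]
    (ξ : ℕ → Ω → ℝ) (hξ : IsErasureProcess μ p ξ)
    (hstab : IsMSEStable μ ξ X f h K) :
    ∃ Q₀ R : EuclideanSpace ℝ (Fin N) → Matrix (Fin N) (Fin N) ℝ,
      (∃ γ₁ γ₂ : ℝ, 0 < γ₁ ∧ 0 < γ₂ ∧ ∀ x ∈ X,
        (Q₀ x - γ₁ • (1 : Matrix (Fin N) (Fin N) ℝ)).PosSemidef ∧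
        (γ₂ • (1 : Matrix (Fin N) (Fin N) ℝ) - Q₀ x).PosSemidef) ∧
      (∀ x ∈ X, (R x).PosSemidef) ∧
      (∀ x ∈ X, Q₀ (f x) = riccatiMap (jacobian f x) (jacobian h x) (R x) (Q₀ x)) ∧
      ∀ᵐ x : EuclideanSpace ℝ (Fin N), x ∈ X →
        (1 - p) ^ M * (jacobian f x).det ^ 2 * ((Q₀ x).det / (Q₀ (f x)).det) < 1 := by
  obtain ⟨γ, P, hγ, hP⟩ := hsys.exists_lyapunov_solution hK hr hp0.le hp1.le hξ hstab
  obtain ⟨a₁, a, -, ha, hA⟩ := hsys.jacobian_bounds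
  obtain ⟨κ, hκ⟩ := hK.deriv_bounded
  have hγ0 : 0 < γ := by linarith
  have hPpos : ∀ x ∈ X, (P x).PosDef := fun x hx => by
    simpa using Matrix.PosDef.one.add_posSemidef (hP x hx).1
  -- The constant of `PosSemidef.riccati_of_lyapunov` with `k = κ ^ 2`; the added 1 keeps it
  -- positive when `κ = 0`.
  set c : ℝ := γ ^ 2 * a * κ ^ 2 + 1 with hc
  have hc0 : 0 < c := by positivity
  have hcP : ∀ x ∈ X, (c⁻¹ • P x).PosDef := fun x hx => (hPpos x hx).smul (inv_pos.2 hc0)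
  have hscalar : ∀ s : ℝ, s ≠ 0 →
      (s • (1 : Matrix (Fin N) (Fin N) ℝ))⁻¹ = s⁻¹ • 1 := fun s hs => by
    refine Matrix.inv_eq_right_inv ?_
    simp [smul_smul, inv_mul_cancel₀ hs]
  refine ⟨fun x => (c⁻¹ • P x)⁻¹, fun x => (c⁻¹ • P (f x))⁻¹ - jacobian f x *
    (c⁻¹ • P x + (jacobian h x)ᵀ * jacobian h x)⁻¹ * (jacobian f x)ᵀ,
    ⟨c / γ, c, by positivity, hc0, fun x hx => ⟨?_, ?_⟩⟩, fun x hx => ?_, fun x hx => ?_,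
    .of_forall fun x hx => ?_⟩
  · have h1 := Matrix.inv_sub_mul_inv_mul_transpose_posSemidef (A := (1 : Matrix (Fin N) (Fin N) ℝ))
      (Matrix.PosDef.one.smul (mul_pos (inv_pos.2 hc0) hγ0)) (hcP x hx) (by
        simpa [smul_sub, smul_smul] using (hP x hx).2.1.smul (inv_pos.2 hc0).le)
    rw [hscalar _ (by positivity)] at h1
    simpa [div_eq_mul_inv, mul_comm] using h1
  · have h1 := Matrix.inv_sub_mul_inv_mul_transpose_posSemidef (A := (1 : Matrix (Fin N) (Fin N) ℝ)) (hcP x hx)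
      (Matrix.PosDef.one.smul (inv_pos.2 hc0)) (by
        simpa [smul_sub, smul_smul] using (hP x hx).1.smul (inv_pos.2 hc0).le)
    rw [hscalar _ (by positivity)] at h1
    simpa using h1
  · have hCC : ((jacobian h x)ᵀ * jacobian h x).PosSemidef := by
      simpa using Matrix.PosSemidef.one.transpose_mul_mul (jacobian h x)
    refine Matrix.inv_sub_mul_inv_mul_transpose_posSemidef ((hcP x hx).add_posSemidef hCC)
      (hcP _ (hsys.mapsTo hx)) ?_
    -- Dividing by `c` turns the multiple of `CᵀC` into `CᵀC` itself, as the information form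
    -- requires.
    have h1 := (Matrix.PosSemidef.riccati_of_lyapunov hp0 hp1 ha hγ0 (sq_nonneg κ) (hP x hx).2.2
      (hPpos _ (hsys.mapsTo hx)).posSemidef (hP _ (hsys.mapsTo hx)).2.1 (hA x hx).2
      (sq_smul_one_sub_jacobian_posSemidef (hκ x hx))).smul (inv_pos.2 hc0).le
    simpa [← hc, smul_sub, smul_add, smul_smul, hc0.ne'] using h1
  · rw [riccatiMap_inv _ _ _ (hcP x hx), add_sub_cancel]
  · have : Nonempty (Fin N) := ⟨⟨M, hMN⟩⟩
    have h1 := Matrix.det_lt_of_lyapunov hp0 hp1 hγ (hP x hx).2.2 (hPpos x hx)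
      (hPpos _ (hsys.mapsTo hx)) (hP x hx).2.1 (hsys.det_jacobian_ne_zero hx)
    have h2 := (hPpos x hx).det_pos
    have h3 := (hPpos _ (hsys.mapsTo hx)).det_pos
    rw [Fintype.card_fin] at h1
    simp only [Matrix.det_nonsing_inv, Ring.inverse_eq_inv', Matrix.det_smul]
    have h4 : ((c⁻¹ ^ Fintype.card (Fin N) * (P x).det)⁻¹ /
        (c⁻¹ ^ Fintype.card (Fin N) * (P (f x)).det)⁻¹) = (P (f x)).det / (P x).det := by
      field_simp
    rw [h4, ← mul_div_assoc, div_lt_one h2]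
    exact h1
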